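/- Let $N$ be a 2-step nilpotent Lie group, i.e. a finite-dimensional real Lie group whose Lie algebra $\mathfrak n$ (identified with $T_eN$ and with the left-invariant vector fields) is nilpotent of class exactly 2, and let $\langle\,,\rangle$ be a left-invariant pseudo-Riemannian metric on $N$. Let $\mathfrak z$ be the center of $\mathfrak n$, assume that the restriction of $\langle\,,\rangle$ to $\mathfrak z$ is non-degenerate, and put $\mathfrak v=\mathfrak z^{\perp}$, so that $\mathfrak n=\mathfrak v\oplus\mathfrak z$. For $n\in N$ let $\mathfrak vN_n=(dL_n)_e\mathfrak v$ and $\mathfrak zN_n=(dL_n)_e\mathfrak z$, where $L_n$ denotes left translation by $n$; these define left-invariant distributions with $TN=\mathfrak vN\oplus\mathfrak zN$. Let $R(X,Y)Z=\nabla_X\nabla_YZ-\nabla_Y\nabla_XZ-\nabla_{[X,Y]}Z$ be the curvature of the Levi-Civita connection $\nabla$, let $\mathrm{Ric}(u,w)=\operatorname{tr}(\xi\mapsto R(\xi,u)w)$ for $u,w\in\mathfrak n$, and let $\mathrm{Rc}:\mathfrak n\to\mathfrak n$ be the Ricci operator, $\langle \mathrm{Rc}\,u,w\rangle=\mathrm{Ric}(u,w)$.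 Let $\lambda_1,\dots,\lambda_s\in\mathbb C$ be the distinct eigenvalues of the complexified operator $\mathrm{Rc}$ on $\mathfrak n^{\mathbb C}=\mathfrak n\otimes_{\mathbb R}\mathbb C$, and let $V_{\lambda_i}\subseteq\mathfrak n^{\mathbb C}$ be the generalized eigenspace of $\lambda_i$. Assume that, for some numbering of the eigenvalues and some $j$, $$\mathfrak v^{\mathbb C}=V_{\lambda_1}\oplus\cdots\oplus V_{\lambda_j},\qquad \mathfrak z^{\mathbb C}=V_{\lambda_{j+1}}\oplus\cdots\oplus V_{\lambda_s}.$$ Let $\mathrm{Iso}(N)$ be the group of isometries of $N$ (smooth diffeomorphisms preserving the metric), and let $\mathrm{Iso}^{spl}(N)$ be the subgroup of those isometries $f$ that preserve the splitting $TN=\mathfrak vN\oplus\mathfrak zN$, i.e. $df_n(\mathfrak vN_n)=\mathfrak vN_{f(n)}$ and $df_n(\mathfrak zN_n)=\mathfrak zN_{f(n)}$ for all $n\in N$. Then every isometry of $N$ preserves the splitting, that is, $$\mathrm{Iso}(N)=\mathrm{Iso}^{spl}(N).$$ -/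

import Mathlib

open Bundle Manifold VectorField
open scoped ContDiff TensorProduct

noncomputable section

section Metric

variable {E : Type*} [NormedAddCommGroup E] [NormedSpace ℝ E]
  {H : Type*} [TopologicalSpace H] (I : ModelWithCorners ℝ E H)
  (M : Type*) [TopologicalSpace M] [ChartedSpace H M] [IsManifold I ∞ M]

/-- A smooth pseudo-Riemannian metric on `M`: a smooth family of nondegenerate symmetric bilinear
forms on the tangent spaces. -/
structure PseudoRiemannianMetric where
  /-- The scalar product on the tangent space at `x`. -/
  val : ∀ x : M, TangentSpace I x →L[ℝ] TangentSpace I x →L[ℝ] ℝ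
  symm : ∀ (x : M) (u v : TangentSpace I x), val x u v = val x v u
  nondegenerate : ∀ (x : M) (u : TangentSpace I x),
    (∀ v : TangentSpace I x, val x u v = 0) → u = 0
  contMDiff : ContMDiff I (I.prod 𝓘(ℝ, E →L[ℝ] E →L[ℝ] ℝ)) ∞
    (fun x : M ↦ TotalSpace.mk' (E →L[ℝ] E →L[ℝ] ℝ)
      (E := fun x : M ↦ TangentSpace I x →L[ℝ] TangentSpace I x →L[ℝ] ℝ) x (val x))

variable {I M}

namespace PseudoRiemannianMetric

variable (g : PseudoRiemannianMetric I M)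

/-- The scalar product at `x`, as an (algebraic) bilinear form. -/
def form (x : M) : LinearMap.BilinForm ℝ (TangentSpace I x) :=
  LinearMap.mk₂ ℝ (fun u v ↦ g.val x u v) (by simp) (by simp) (by simp) (by simp)

@[simp]
lemma form_apply (x : M) (u v : TangentSpace I x) : g.form x u v = g.val x u v := rfl

lemma form_nondegenerate (x : M) : (g.form x).Nondegenerate :=
  ⟨fun u h ↦ g.nondegenerate x u h,
    fun v h ↦ g.nondegenerate x v fun u ↦ (g.symm x v u).trans (h u)⟩

lemma mdifferentiableAt_val {Y Z : Π x : M, TangentSpace I x} {x : M}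
    (hY : MDiffAt (T% Y) x) (hZ : MDiffAt (T% Z) x) :
    MDiffAt (fun y ↦ g.val y (Y y) (Z y)) x := by
  have : MDifferentiableAt I (I.prod 𝓘(ℝ))
      (fun m ↦ TotalSpace.mk' ℝ (E := Bundle.Trivial M ℝ) m (g.val m (Y m) (Z m))) x := by
    apply MDifferentiableAt.clm_bundle_apply₂ (F₁ := E) (F₂ := E)
    · exact g.contMDiff.mdifferentiableAt (by simp)
    · exact hY
    · exact hZ
  simp only [mdifferentiableAt_totalSpace] at this
  exact this.2

/-- The right-hand side of the Koszul formula for `2 g(∇_X Y, Z)`: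
`X g(Y,Z) + Y g(X,Z) - Z g(X,Y) + g([X,Y],Z) - g([X,Z],Y) - g([Y,Z],X)`. -/
def koszul (X Y Z : Π x : M, TangentSpace I x) (x : M) : ℝ :=
  d% (fun y ↦ g.val y (Y y) (Z y)) x (X x) + d% (fun y ↦ g.val y (X y) (Z y)) x (Y x)
    - d% (fun y ↦ g.val y (X y) (Y y)) x (Z x)
    + g.val x (mlieBracket I X Y x) (Z x) - g.val x (mlieBracket I X Z x) (Y x)
    - g.val x (mlieBracket I Y Z x) (X x)

variable {X X' Y Y' Z Z' : Π x : M, TangentSpace I x} {x : M} {f : M → ℝ}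

lemma mvfderiv_add_left (hX : MDiffAt (T% X) x) (hX' : MDiffAt (T% X') x)
    (hZ : MDiffAt (T% Z) x) (u : TangentSpace I x) :
    d% (fun y ↦ g.val y ((X + X') y) (Z y)) x u =
      d% (fun y ↦ g.val y (X y) (Z y)) x u + d% (fun y ↦ g.val y (X' y) (Z y)) x u := by
  have : (fun y ↦ g.val y ((X + X') y) (Z y)) =
      (fun y ↦ g.val y (X y) (Z y)) + (fun y ↦ g.val y (X' y) (Z y)) := by
    ext y; simp
  rw [this, mvfderiv_add (g.mdifferentiableAt_val hX hZ) (g.mdifferentiableAt_val hX' hZ)]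
  rfl

lemma mvfderiv_smul_left (hf : MDiffAt f x) (hX : MDiffAt (T% X) x) (hZ : MDiffAt (T% Z) x)
    (u : TangentSpace I x) :
    d% (fun y ↦ g.val y ((f • X) y) (Z y)) x u =
      f x * d% (fun y ↦ g.val y (X y) (Z y)) x u + d% f x u * g.val x (X x) (Z x) := by
  have : (fun y ↦ g.val y ((f • X) y) (Z y)) = f * (fun y ↦ g.val y (X y) (Z y)) := by
    ext y; simp
  rw [this, mvfderiv_mul hf (g.mdifferentiableAt_val hX hZ)]
  simp
  ring

lemma mvfderiv_symm (u : TangentSpace I x) :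
    d% (fun y ↦ g.val y (X y) (Z y)) x u = d% (fun y ↦ g.val y (Z y) (X y)) x u := by
  simp only [g.symm _ (X _)]

lemma mvfderiv_add_right (hX : MDiffAt (T% X) x) (hX' : MDiffAt (T% X') x)
    (hZ : MDiffAt (T% Z) x) (u : TangentSpace I x) :
    d% (fun y ↦ g.val y (Z y) ((X + X') y)) x u =
      d% (fun y ↦ g.val y (Z y) (X y)) x u + d% (fun y ↦ g.val y (Z y) (X' y)) x u := by
  simp only [g.mvfderiv_symm (X := Z), g.mvfderiv_add_left hX hX' hZ]

lemma mvfderiv_smul_right (hf : MDiffAt f x) (hX : MDiffAt (T% X) x) (hZ : MDiffAt (T% Z) x)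
    (u : TangentSpace I x) :
    d% (fun y ↦ g.val y (Z y) ((f • X) y)) x u =
      f x * d% (fun y ↦ g.val y (Z y) (X y)) x u + d% f x u * g.val x (X x) (Z x) := by
  simp only [g.mvfderiv_symm (X := Z), g.mvfderiv_smul_left hf hX hZ]

lemma ext_val {u v : TangentSpace I x} (h : ∀ w, g.val x u w = g.val x v w) : u = v :=
  sub_eq_zero.1 (g.nondegenerate x _ fun w ↦ by simp [h])

/-- The isometry group of `(M, g)`: the smooth diffeomorphisms of `M` whose differentials preserve
the metric, under composition. -/
def isometryGroup : Subgroup (Equiv.Perm M) where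
  carrier := {f | ContMDiff I I ∞ f ∧ ContMDiff I I ∞ f.symm ∧
    ∀ (x : M) (u v : TangentSpace I x),
      g.val (f x) (mfderiv I I f x u) (mfderiv I I f x v) = g.val x u v}
  mul_mem' := by
    rintro f₁ f₂ ⟨h₁, h₁', h₁''⟩ ⟨h₂, h₂', h₂''⟩
    refine ⟨h₁.comp h₂, h₂'.comp h₁', fun x u v ↦ ?_⟩
    have : mfderiv I I (f₁ * f₂) x = (mfderiv I I f₁ (f₂ x)).comp (mfderiv I I f₂ x) :=
      mfderiv_comp x (h₁.mdifferentiableAt (by simp)) (h₂.mdifferentiableAt (by simp))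
    rw [this]
    exact (h₁'' _ _ _).trans (h₂'' _ _ _)
  one_mem' := by
    refine ⟨contMDiff_id, contMDiff_id, fun x u v ↦ ?_⟩
    have : mfderiv I I (1 : Equiv.Perm M) x = ContinuousLinearMap.id ℝ _ := mfderiv_id
    rw [this]
    rfl
  inv_mem' := by
    rintro f ⟨h, h', h''⟩
    refine ⟨h', h, fun x u v ↦ ?_⟩
    obtain ⟨y, rfl⟩ := f.surjective x
    have hc : (mfderiv I I f (f.symm (f y))).comp (mfderiv I I f.symm (f y)) =
        ContinuousLinearMap.id ℝ _ := by
      rw [← mfderiv_comp (f y) (h.mdifferentiableAt (by simp)) (h'.mdifferentiableAt (by simp))]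
      have : f ∘ f.symm = id := by ext; simp
      rw [this, mfderiv_id]
    have := h'' (f.symm (f y)) (mfderiv I I f.symm (f y) u) (mfderiv I I f.symm (f y) v)
    refine this.symm.trans ?_
    have e (w : TangentSpace I (f y)) :
        mfderiv I I f (f.symm (f y)) (mfderiv I I f.symm (f y) w) = w := congr($hc w)
    have e' : f (f.symm (f y)) = f y := by simp
    have e'' (b : M) (hb : b = f y) (u' v' : E) (hu : u' = u) (hv : v' = v) :
        g.val b u' v' = g.val (f y) u v := by
      subst hb hu hv; rfl
    exact e'' _ e' _ _ (e u) (e v)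

variable [FiniteDimensional ℝ E]

lemma koszul_tensorialAt_left (hY : MDiffAt (T% Y) x) (hZ : MDiffAt (T% Z) x) :
    TensorialAt I E (fun X ↦ g.koszul X Y Z x) x where
  smul {f X} hf hX := by
    simp only [koszul, g.mvfderiv_smul_left hf hX hY, g.mvfderiv_smul_left hf hX hZ,
      mlieBracket_smul_left hf hX]
    simp
    ring
  add {X X'} hX hX' := by
    simp only [koszul, g.mvfderiv_add_left hX hX' hY, g.mvfderiv_add_left hX hX' hZ,
      mlieBracket_add_left hX hX']
    simp
    ring

lemma koszul_tensorialAt_right (hX : MDiffAt (T% X) x) (hY : MDiffAt (T% Y) x) :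
    TensorialAt I E (fun Z ↦ g.koszul X Y Z x) x where
  smul {f Z} hf hZ := by
    simp only [koszul, g.mvfderiv_smul_right hf hZ hX, g.mvfderiv_smul_right hf hZ hY,
      mlieBracket_smul_right hf hZ]
    simp
    ring
  add {Z Z'} hZ hZ' := by
    simp only [koszul, g.mvfderiv_add_right hZ hZ' hX, g.mvfderiv_add_right hZ hZ' hY,
      mlieBracket_add_right hZ hZ']
    simp
    ring

lemma koszul_add_mid (hX : MDiffAt (T% X) x) (hY : MDiffAt (T% Y) x) (hY' : MDiffAt (T% Y') x)
    (hZ : MDiffAt (T% Z) x) :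
    g.koszul X (Y + Y') Z x = g.koszul X Y Z x + g.koszul X Y' Z x := by
  simp only [koszul, g.mvfderiv_add_left hY hY' hZ, g.mvfderiv_add_right hY hY' hX,
    mlieBracket_add_left hY hY', mlieBracket_add_right hY hY']
  simp
  ring

lemma koszul_smul_mid (hf : MDiffAt f x) (hX : MDiffAt (T% X) x) (hY : MDiffAt (T% Y) x)
    (hZ : MDiffAt (T% Z) x) :
    g.koszul X (f • Y) Z x = f x * g.koszul X Y Z x + 2 * d% f x (X x) * g.val x (Y x) (Z x) := by
  simp only [koszul, g.mvfderiv_smul_left hf hY hZ, g.mvfderiv_smul_right hf hY hX,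
    mlieBracket_smul_left hf hY, mlieBracket_smul_right hf hY]
  simp [g.symm x (Y x) (X x)]
  ring

instance tangentSpace_t2Space (x : M) : T2Space (TangentSpace I x) :=
  inferInstanceAs (T2Space E)

instance tangentSpace_finiteDimensional (x : M) : FiniteDimensional ℝ (TangentSpace I x) :=
  inferInstanceAs (FiniteDimensional ℝ E)

open Classical in
/-- The Levi-Civita covariant derivative `(Y, x) ↦ (u ↦ ∇_u Y)`: where `Y` is differentiable at `x`,
`∇_u Y` is the vector at `x` representing half of the Koszul expression through the metric. (As for
every Mathlib covariant derivative, the value for `Y` not differentiable at `x` is irrelevant.) -/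
def leviCivitaFun (Y : Π x : M, TangentSpace I x) (x : M) :
    TangentSpace I x →L[ℝ] TangentSpace I x :=
  if hY : MDiffAt (T% Y) x then
    LinearMap.toContinuousLinearMap
      (((g.form x).toDual (g.form_nondegenerate x)).symm.toLinearMap ∘ₗ
        ((1 / 2 : ℝ) • (LinearMap.mk₂ ℝ
          (fun u w ↦ TensorialAt.mkHom₂ (fun X Z ↦ g.koszul X Y Z x) x
            (fun _ hZ ↦ g.koszul_tensorialAt_left hY hZ)
            (fun _ hX ↦ g.koszul_tensorialAt_right hX hY) u w)
          (by simp) (by simp) (by simp) (by simp) : LinearMap.BilinForm ℝ (TangentSpace I x))))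
  else 0

lemma leviCivitaFun_apply (hX : MDiffAt (T% X) x) (hY : MDiffAt (T% Y) x)
    (hZ : MDiffAt (T% Z) x) :
    2 * g.val x (g.leviCivitaFun Y x (X x)) (Z x) = g.koszul X Y Z x := by
  rw [leviCivitaFun, dif_pos hY, ← g.form_apply]
  simp only [LinearMap.coe_toContinuousLinearMap', LinearMap.comp_apply, LinearEquiv.coe_coe,
    LinearMap.BilinForm.apply_toDual_symm_apply]
  simp [TensorialAt.mkHom₂_apply (fun _ hZ ↦ g.koszul_tensorialAt_left hY hZ)
            (fun _ hX ↦ g.koszul_tensorialAt_right hX hY) hX hZ]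

/-- The Levi-Civita connection of `g`. It is torsion-free and compatible with the metric, see
`leviCivita_torsion` and `leviCivita_metric`.
Note the argument order: `g.leviCivita Y x (X x)` is `(∇_X Y)(x)`. -/
def leviCivita : CovariantDerivative I E (TangentSpace I : M → Type _) where
  toFun := g.leviCivitaFun
  isCovariantDerivativeOnUniv :=
    { add := by
        intro Y Y' x hY hY' _
        ext u
        refine g.ext_val fun w ↦ ?_
        have hu := FiberBundle.mdifferentiableAt_extend I E u
        have hw := FiberBundle.mdifferentiableAt_extend I E w
        have h1 := g.leviCivitaFun_apply hu (mdifferentiableAt_add_section hY hY') hw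
        have h2 := g.leviCivitaFun_apply hu hY hw
        have h3 := g.leviCivitaFun_apply hu hY' hw
        rw [g.koszul_add_mid hu hY hY' hw] at h1
        simp only [FiberBundle.extend_apply_self] at h1 h2 h3
        simp
        linarith
      leibniz := by
        intro Y f x hY hf _
        ext u
        refine g.ext_val fun w ↦ ?_
        have hu := FiberBundle.mdifferentiableAt_extend I E u
        have hw := FiberBundle.mdifferentiableAt_extend I E w
        have h1 := g.leviCivitaFun_apply hu (hf.smul_section hY) hw
        have h2 := g.leviCivitaFun_apply hu hY hw
        rw [g.koszul_smul_mid hf hu hY hw] at h1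
        simp only [FiberBundle.extend_apply_self] at h1 h2
        simp
        linear_combination h1 / 2 - f x * h2 / 2 }

lemma leviCivita_apply (hX : MDiffAt (T% X) x) (hY : MDiffAt (T% Y) x) (hZ : MDiffAt (T% Z) x) :
    2 * g.val x (g.leviCivita Y x (X x)) (Z x) = g.koszul X Y Z x :=
  g.leviCivitaFun_apply hX hY hZ

theorem leviCivita_torsion : g.leviCivita.torsion = 0 := by
  refine g.leviCivita.torsion_eq_zero_iff.2 fun {X Y x} hX hY ↦ g.ext_val fun w ↦ ?_
  have hw := FiberBundle.mdifferentiableAt_extend I E w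
  have h1 := g.leviCivita_apply hX hY hw
  have h2 := g.leviCivita_apply hY hX hw
  simp only [koszul, FiberBundle.extend_apply_self, mlieBracket_swap_apply (V := Y) (W := X),
    g.mvfderiv_symm (X := Y) (Z := X)] at h1 h2
  simp at h1 h2 ⊢
  linarith

theorem leviCivita_metric (hX : MDiffAt (T% X) x) (hY : MDiffAt (T% Y) x)
    (hZ : MDiffAt (T% Z) x) :
    d% (fun y ↦ g.val y (Y y) (Z y)) x (X x) =
      g.val x (g.leviCivita Y x (X x)) (Z x) + g.val x (Y x) (g.leviCivita Z x (X x)) := by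
  have h1 := g.leviCivita_apply hX hY hZ
  have h2 := g.leviCivita_apply hX hZ hY
  rw [g.symm x (Y x)]
  simp only [koszul, mlieBracket_swap_apply (V := Z) (W := Y),
    g.mvfderiv_symm (X := Z) (Z := Y)] at h1 h2
  simp at h1 h2 ⊢
  linarith

end PseudoRiemannianMetric

/-- The curvature `R(X, Y)Z = ∇_X ∇_Y Z - ∇_Y ∇_X Z - ∇_[X,Y] Z` of an affine connection. -/
def curvature [FiniteDimensional ℝ E] (cov : CovariantDerivative I E (TangentSpace I : M → Type _))
    (X Y Z : Π x : M, TangentSpace I x) (x : M) : TangentSpace I x :=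
  cov (fun y ↦ cov Z y (Y y)) x (X x) - cov (fun y ↦ cov Z y (X y)) x (Y x)
    - cov Z x (mlieBracket I X Y x)

end Metric

section LieGroup

variable {E : Type*} [NormedAddCommGroup E] [NormedSpace ℝ E]
  {H : Type*} [TopologicalSpace H] (I : ModelWithCorners ℝ E H)
  (N : Type*) [TopologicalSpace N] [ChartedSpace H N] [Group N] [LieGroup I ∞ N]

instance lieGroup_minSmoothness : LieGroup I (minSmoothness ℝ 3) N := by
  rw [minSmoothness_of_isRCLikeNormedField]
  infer_instance

/-- A left-invariant pseudo-Riemannian metric on the Lie group `N`: one for which all left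
translations `p ↦ a * p` preserve the metric. -/
structure LeftInvariantMetric extends PseudoRiemannianMetric I N where
  left_invariant : ∀ (a p : N) (u v : TangentSpace I p),
    val (a * p) (mfderiv I I (a * ·) p u) (mfderiv I I (a * ·) p v) = val p u v

variable {I N}

/-- The isomorphism `(dL_n)_e` from the Lie algebra to the tangent space at `n`. -/
def leftInvariantFieldAt (n : N) : GroupLieAlgebra I N →ₗ[ℝ] TangentSpace I n where
  toFun w := mulInvariantVectorField w n
  map_add' u v := by rw [mulInvariantVectorField_add]; rfl
  map_smul' c v := by rw [mulInvariantVectorField_smul]; rfl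

/-- The left-invariant distribution `WN`, with `(WN)_n = (dL_n)_e W`, for `W` a subspace of the Lie
algebra. -/
def leftInvariantDistribution (W : Submodule ℝ (GroupLieAlgebra I N)) (n : N) :
    Submodule ℝ (TangentSpace I n) :=
  W.map (leftInvariantFieldAt n)

lemma mulInvariantVectorField_one (u : GroupLieAlgebra I N) : mulInvariantVectorField u 1 = u := by
  have : (fun x : N ↦ 1 * x) = id := by ext; simp
  rw [mulInvariantVectorField, this, mfderiv_id]
  rfl

lemma exists_mulInvariantVectorField_eq (n : N) (v : TangentSpace I n) :
    ∃ w : GroupLieAlgebra I N, mulInvariantVectorField w n = v := by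
  have hd (a p : N) : MDifferentiableAt I I (fun x ↦ a * x) p :=
    (contMDiff_mul_left (I := I) (n := ∞) (a := a)).mdifferentiableAt (by simp)
  have e : n * (n⁻¹ * n) = n := by simp
  have h := mfderiv_comp (I := I) (I' := I) (I'' := I) n (g := fun x ↦ n * x)
    (f := fun x ↦ n⁻¹ * x) (hd n _) (hd n⁻¹ _)
  have h0 : (fun x ↦ n * x) ∘ (fun x ↦ n⁻¹ * x) = id := by ext; simp
  rw [h0, mfderiv_id] at h
  have key : ∀ b : N, b = 1 → ∀ w : TangentSpace I b,
      (mfderiv I I (fun x ↦ n * x) b w : E) = mulInvariantVectorField (I := I) (w : E) n := by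
    rintro b rfl w; rfl
  refine ⟨(mfderiv I I (fun x ↦ n⁻¹ * x) n v : E), ?_⟩
  refine (key (n⁻¹ * n) (by simp) _).symm.trans ?_
  exact congr($h v).symm

namespace LeftInvariantMetric

variable (g : LeftInvariantMetric I N)

lemma val_mulInvariantVectorField (u v : GroupLieAlgebra I N) (n : N) :
    g.val n (mulInvariantVectorField u n) (mulInvariantVectorField v n) = g.val 1 u v := by
  rw [← g.left_invariant n 1 u v]
  have : ∀ b : N, b = n → g.val n (mulInvariantVectorField u n) (mulInvariantVectorField v n) =
      g.val b (mulInvariantVectorField u n : E) (mulInvariantVectorField v n : E) := by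
    rintro b rfl; rfl
  exact this _ (mul_one n)

variable [FiniteDimensional ℝ E]

/-- The Levi-Civita connection on left-invariant vector fields: `(u, w) ↦ (∇_u w)(e)`. -/
def connection : GroupLieAlgebra I N →ₗ[ℝ] GroupLieAlgebra I N →ₗ[ℝ] GroupLieAlgebra I N :=
  LinearMap.mk₂ ℝ (fun u w ↦ g.leviCivita (mulInvariantVectorField w) 1 u)
    (by simp) (by simp)
    (by
      intro u w w'
      have h := g.leviCivita.isCovariantDerivativeOnUniv.add (x := 1)
        (mdifferentiable_mulInvariantVectorField w 1)
        (mdifferentiable_mulInvariantVectorField w' 1)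
      rw [mulInvariantVectorField_add]
      exact congr($h u))
    (by
      intro c u w
      have h := g.leviCivita.isCovariantDerivativeOnUniv.smul_const (x := 1) c
        (mdifferentiable_mulInvariantVectorField w 1)
      rw [mulInvariantVectorField_smul]
      exact congr($h u))

lemma leviCivita_mulInvariantVectorField (u w : GroupLieAlgebra I N) (n : N) :
    g.leviCivita (mulInvariantVectorField w) n (mulInvariantVectorField u n) =
      mulInvariantVectorField (g.connection u w) n := by
  refine g.ext_val fun z ↦ ?_
  obtain ⟨z, rfl⟩ := exists_mulInvariantVectorField_eq n z
  have hb (a b : GroupLieAlgebra I N) (p : N) :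
      mlieBracket I (mulInvariantVectorField a) (mulInvariantVectorField b) p =
        mulInvariantVectorField ⁅a, b⁆ p :=
    (congrFun (mulInvariantVector_mlieBracket a b) p).symm
  have key : ∀ p : N, 2 * g.val p (g.leviCivita (mulInvariantVectorField w) p
      (mulInvariantVectorField u p)) (mulInvariantVectorField z p) =
      g.val 1 ⁅u, w⁆ z - g.val 1 ⁅u, z⁆ w - g.val 1 ⁅w, z⁆ u := by
    intro p
    rw [g.leviCivita_apply (mdifferentiable_mulInvariantVectorField u p)
      (mdifferentiable_mulInvariantVectorField w p) (mdifferentiable_mulInvariantVectorField z p)]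
    simp only [PseudoRiemannianMetric.koszul, val_mulInvariantVectorField, mvfderiv_const,
      hb, val_mulInvariantVectorField]
    simp
  have h1 := key n
  have h2 := key 1
  rw [mulInvariantVectorField_one, mulInvariantVectorField_one] at h2
  rw [val_mulInvariantVectorField]
  change 2 * g.val 1 (g.connection u w) z = _ at h2
  linarith

lemma curvature_mulInvariantVectorField (u v w : GroupLieAlgebra I N) :
    curvature g.leviCivita (mulInvariantVectorField u) (mulInvariantVectorField v)
      (mulInvariantVectorField w) 1 =
    g.connection u (g.connection v w) - g.connection v (g.connection u w)
      - g.connection ⁅u, v⁆ w := by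
  simp only [curvature, leviCivita_mulInvariantVectorField, mulInvariantVectorField_one]
  rfl

/-- The endomorphism `ξ ↦ R(ξ, u)w` of the Lie algebra, where Lie algebra elements are regarded as
left-invariant vector fields and `R` is the curvature of the Levi-Civita connection. -/
def curvatureEndo (u w : GroupLieAlgebra I N) : Module.End ℝ (GroupLieAlgebra I N) where
  toFun ξ := curvature g.leviCivita (mulInvariantVectorField ξ) (mulInvariantVectorField u)
    (mulInvariantVectorField w) 1
  map_add' ξ η := by
    simp only [curvature_mulInvariantVectorField, map_add, LinearMap.add_apply, add_lie]
    abel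
  map_smul' c ξ := by
    simp only [curvature_mulInvariantVectorField, map_smul, LinearMap.smul_apply, smul_lie,
      RingHom.id_apply, smul_sub]

lemma curvatureEndo_apply (u w ξ : GroupLieAlgebra I N) : g.curvatureEndo u w ξ =
    g.connection ξ (g.connection u w) - g.connection u (g.connection ξ w)
      - g.connection ⁅ξ, u⁆ w :=
  g.curvature_mulInvariantVectorField ξ u w

/-- The Ricci tensor on the Lie algebra: `Ric(u, w) = tr (ξ ↦ R(ξ, u)w)`. -/
def ricci : LinearMap.BilinForm ℝ (GroupLieAlgebra I N) :=
  LinearMap.mk₂ ℝ (fun u w ↦ LinearMap.trace ℝ _ (g.curvatureEndo u w))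
    (fun u u' w ↦ by
      rw [← map_add]
      congr 1
      ext ξ
      simp only [curvatureEndo_apply, map_add, LinearMap.add_apply, lie_add]
      abel)
    (fun c u w ↦ by
      rw [← map_smul]
      congr 1
      ext ξ
      simp only [curvatureEndo_apply, map_smul, LinearMap.smul_apply, lie_smul, smul_sub])
    (fun u w w' ↦ by
      rw [← map_add]
      congr 1
      ext ξ
      simp only [curvatureEndo_apply, map_add, LinearMap.add_apply]
      abel)
    (fun c u w ↦ by
      rw [← map_smul]
      congr 1
      ext ξ
      simp only [curvatureEndo_apply, map_smul, LinearMap.smul_apply, smul_sub])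

/-- The Ricci operator `Rc` on the Lie algebra: `⟨Rc u, w⟩ = Ric(u, w)`. -/
def ricciOperator : Module.End ℝ (GroupLieAlgebra I N) :=
  ((g.form 1).toDual (g.form_nondegenerate 1)).symm.toLinearMap ∘ₗ g.ricci

lemma ricciOperator_apply (u w : GroupLieAlgebra I N) :
    g.val 1 (g.ricciOperator u) w = g.ricci u w :=
  LinearMap.BilinForm.apply_toDual_symm_apply (hB := g.form_nondegenerate 1) (g.ricci u) w

/-- The complexification of the Ricci operator. -/
abbrev complexRicciOperator : Module.End ℂ (ℂ ⊗[ℝ] GroupLieAlgebra I N) :=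
  g.ricciOperator.baseChange ℂ

variable (I N) in
/-- The center `𝔷` of the Lie algebra, as a subspace. -/
abbrev centerSubspace : Submodule ℝ (GroupLieAlgebra I N) :=
  (LieAlgebra.center ℝ (GroupLieAlgebra I N)).toSubmodule

/-- The center is nondegenerate: the scalar product restricts to a nondegenerate form on `𝔷`. -/
def HasNondegenerateCenter : Prop :=
  ((g.form 1).restrict (centerSubspace I N)).Nondegenerate

/-- The orthogonal complement `𝔳` of the center. -/
def orthogonalCenter : Submodule ℝ (GroupLieAlgebra I N) :=
  (g.form 1).orthogonal (centerSubspace I N)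

/-- `Iso^spl(N)`: the isometries `f` that preserve the splitting `TN = 𝔳N ⊕ 𝔷N`, that is
`df_n (𝔳N)_n = (𝔳N)_{f(n)}` and `df_n (𝔷N)_n = (𝔷N)_{f(n)}` for all `n`. -/
def splittingIsometryGroup : Subgroup (Equiv.Perm N) where
  carrier := {f | f ∈ g.isometryGroup ∧ ∀ n : N,
    (leftInvariantDistribution g.orthogonalCenter n).map (mfderiv I I f n).toLinearMap =
      leftInvariantDistribution g.orthogonalCenter (f n) ∧
    (leftInvariantDistribution (centerSubspace I N) n).map (mfderiv I I f n).toLinearMap =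
      leftInvariantDistribution (centerSubspace I N) (f n)}
  mul_mem' := by
    rintro f₁ f₂ ⟨h₁, h₁'⟩ ⟨h₂, h₂'⟩
    refine ⟨mul_mem h₁ h₂, fun n ↦ ?_⟩
    have : mfderiv I I (f₁ * f₂) n = (mfderiv I I f₁ (f₂ n)).comp (mfderiv I I f₂ n) :=
      mfderiv_comp n (h₁.1.mdifferentiableAt (by simp)) (h₂.1.mdifferentiableAt (by simp))
    rw [this]
    constructor
    · refine (Submodule.map_comp _ _ _).trans ?_
      rw [(h₂' n).1]
      exact (h₁' (f₂ n)).1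
    · refine (Submodule.map_comp _ _ _).trans ?_
      rw [(h₂' n).2]
      exact (h₁' (f₂ n)).2
  one_mem' := by
    refine ⟨one_mem _, fun n ↦ ?_⟩
    have : mfderiv I I (1 : Equiv.Perm N) n = ContinuousLinearMap.id ℝ _ := mfderiv_id
    rw [this]
    exact ⟨Submodule.map_id _, Submodule.map_id _⟩
  inv_mem' := by
    rintro f ⟨h, h'⟩
    refine ⟨inv_mem h, fun n ↦ ?_⟩
    obtain ⟨y, rfl⟩ := f.surjective n
    have hc : (mfderiv I I f.symm (f y)).comp (mfderiv I I f y) =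
        ContinuousLinearMap.id ℝ _ := by
      rw [← mfderiv_comp y (h.2.1.mdifferentiableAt (by simp)) (h.1.mdifferentiableAt (by simp))]
      have : f.symm ∘ f = id := by ext; simp
      rw [this, mfderiv_id]
    have key (W : Submodule ℝ (GroupLieAlgebra I N))
        (hW : (leftInvariantDistribution W y).map (mfderiv I I f y).toLinearMap =
          leftInvariantDistribution W (f y)) :
        (leftInvariantDistribution W (f y)).map (mfderiv I I f.symm (f y)).toLinearMap =
          leftInvariantDistribution W (f.symm (f y)) := by
      rw [← hW]
      have e : ∀ b : N, b = y → (leftInvariantDistribution W y : Submodule ℝ E) =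
          leftInvariantDistribution W b := by
        rintro b rfl; rfl
      refine Eq.trans ?_ (e _ (f.symm_apply_apply y))
      refine (Submodule.map_comp _ _ _).symm.trans ?_
      have hc' : (mfderiv I I f.symm (f y)).toLinearMap ∘ₗ (mfderiv I I f y).toLinearMap =
          (LinearMap.id : E →ₗ[ℝ] E) := congr(($hc).toLinearMap)
      exact (congrArg (Submodule.map · (leftInvariantDistribution W y)) hc').trans
        (Submodule.map_id _)
    exact ⟨key _ (h' y).1, key _ (h' y).2⟩

end LeftInvariantMetric

end LieGroup

end

/-!
An isometry preserves everything that is built naturally from the metric, in particular the Ricci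
operator; so its differential, read in left-invariant frames, commutes with `Rc` and preserves the
generalized eigenspaces of the complexification of `Rc`. As `𝔳 ⊗ ℂ` and `𝔷 ⊗ ℂ` are sums of such
eigenspaces, the differential preserves `𝔳` and `𝔷`.

Precisely, let `f` be an isometry and `n` a point. The linear automorphism `A` of the Lie algebra
with `df_n (u_n) = (A u)_{f n}`, where `u` also denotes the left-invariant field, is
`frameDifferential`; it preserves the scalar product. The field `f^*(A u)` is not left-invariant,
but it agrees with `u` at `n`. By the Koszul formula the Levi-Civita connection, and with it the
curvature, commutes with pullback along `f` (`leviCivita_mpullback`, `curvature_mpullback`). The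
remaining point is that the curvature at `n` depends only on the values at `n` of its three
arguments (`curvature_congr`). This is deduced from additivity and homogeneity over functions in
each slot, by expanding a field in a left-invariant frame. Homogeneity in the third slot rests on
`[X, Y] h = X (Y h) - Y (X h)` for functions `h`, which is obtained from the Jacobi identity for
`X`, `Y` and `h Z`. Hence `A (R(ξ, u)w) = R(A ξ, A u)(A w)`; taking the trace over `ξ` shows that `A`
preserves `Ric`, and so commutes with `Rc`.

Left-invariant fields are only known to be `C²` in Mathlib, so `C²` is the regularity of the fields
throughout.
-/

noncomputable section

/-! ### Vector fields as derivations -/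

section VectorFields

variable {E : Type*} [NormedAddCommGroup E] [NormedSpace ℝ E]
  {H : Type*} [TopologicalSpace H] {I : ModelWithCorners ℝ E H}
  {M : Type*} [TopologicalSpace M] [ChartedSpace H M] [IsManifold I ∞ M]

lemma mdifferentiable_mvfderiv_apply {f : M → ℝ} {X : Π x : M, TangentSpace I x}
    (hf : CMDiff 2 f) (hX : CMDiff 1 (T% X)) : MDiff (fun y ↦ d% f y (X y)) := by
  have h1 : ContMDiff I 𝓘(ℝ, ℝ).tangent 1 (fun y ↦ tangentMap I 𝓘(ℝ, ℝ) f (T% X y)) :=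
    (hf.contMDiff_tangentMap (m := 1) (by norm_num)).comp hX
  intro x
  have h2 := (contMDiffAt_totalSpace.1 (h1 x)).2
  have h3 := h2.mdifferentiableAt (by simp)
  refine h3.congr_of_eventuallyEq (Filter.Eventually.of_forall fun y ↦ ?_)
  simp [tangentMap, mvfderiv]
  rfl

lemma contMDiff_mlieBracket [FiniteDimensional ℝ E] {X Y : Π x : M, TangentSpace I x}
    (hX : CMDiff 2 (T% X)) (hY : CMDiff 2 (T% Y)) : CMDiff 1 (T% (mlieBracket I X Y)) := by
  have : CompleteSpace E := FiniteDimensional.complete ℝ E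
  have : IsManifold I (minSmoothness ℝ 3) M := by
    rw [minSmoothness_of_isRCLikeNormedField]
    infer_instance
  have : IsManifold I ((2 : ℕ∞) + 1) M := IsManifold.of_le (n := ∞) (by exact_mod_cast le_top)
  refine ContDiff.mlieBracket_vectorField (n := 2) (m := 1) hX hY ?_
  rw [minSmoothness_of_isRCLikeNormedField]
  norm_num

/-- The derivation along `[X, Y]` is the commutator of those along `X` and `Y`, tested against an
arbitrary vector field `Z`: the identity is the coefficient of `Z` in the Jacobi identity for
`X`, `Y` and `f • Z`. -/
lemma mvfderiv_mlieBracket_smul [FiniteDimensional ℝ E] {f : M → ℝ}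
    {X Y Z : Π x : M, TangentSpace I x} (hf : CMDiff 2 f) (hX : CMDiff 2 (T% X))
    (hY : CMDiff 2 (T% Y)) (hZ : CMDiff 2 (T% Z)) (x : M) :
    (d% (fun y ↦ d% f y (Y y)) x (X x) - d% (fun y ↦ d% f y (X y)) x (Y x) -
      d% f x (mlieBracket I X Y x)) • Z x = 0 := by
  have : CompleteSpace E := FiniteDimensional.complete ℝ E
  have : IsManifold I (minSmoothness ℝ 3) M := by
    rw [minSmoothness_of_isRCLikeNormedField]
    infer_instance
  have h2 : (minSmoothness ℝ 2) = 2 := minSmoothness_of_isRCLikeNormedField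
  have J := leibniz_identity_mlieBracket_apply (U := X) (V := Y) (W := f • Z) (x := x)
    (by rw [h2]; exact hX x) (by rw [h2]; exact hY x) (by rw [h2]; exact (hf.smul_section hZ) x)
  have J0 := leibniz_identity_mlieBracket_apply (U := X) (V := Y) (W := Z) (x := x)
    (by rw [h2]; exact hX x) (by rw [h2]; exact hY x) (by rw [h2]; exact hZ x)
  have hfd : MDiff f := hf.mdifferentiable (by simp)
  have hZd : MDiff (T% Z) := hZ.mdifferentiable (by simp)
  have e (V : Π x : M, TangentSpace I x) : mlieBracket I V (f • Z) =
      (fun y ↦ d% f y (V y)) • Z + f • mlieBracket I V Z :=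
    funext fun y ↦ mlieBracket_smul_right (hfd y) (hZd y)
  have e2 (V W : Π x : M, TangentSpace I x) (hV : CMDiff 2 (T% V)) :
      mlieBracket I W (mlieBracket I V (f • Z)) x =
      d% (fun y ↦ d% f y (V y)) x (W x) • Z x + d% f x (V x) • mlieBracket I W Z x
      + (d% f x (W x) • mlieBracket I V Z x + f x • mlieBracket I W (mlieBracket I V Z) x) := by
    have h1 := mdifferentiable_mvfderiv_apply hf (hV.of_le one_le_two) x
    have h3 := (contMDiff_mlieBracket hV hZ).mdifferentiable (by simp) x
    rw [e, mlieBracket_add_right (h1.smul_section (hZd x)) ((hfd x).smul_section h3),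
      mlieBracket_smul_right h1 (hZd x), mlieBracket_smul_right (hfd x) h3]
  rw [e2 Y X hY, e2 X Y hX, e, J0] at J
  simp only [Pi.add_apply, Pi.smul_apply', smul_add] at J
  rw [← sub_eq_zero] at J
  rw [sub_smul, sub_smul, ← J]
  abel

end VectorFields

/-! ### Naturality of the Levi-Civita connection and the curvature under isometries -/

namespace PseudoRiemannianMetric

variable {E : Type*} [NormedAddCommGroup E] [NormedSpace ℝ E]
  {H : Type*} [TopologicalSpace H] {I : ModelWithCorners ℝ E H}
  {M : Type*} [TopologicalSpace M] [ChartedSpace H M] [IsManifold I ∞ M]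
  (g : PseudoRiemannianMetric I M)

lemma contMDiff_val {Y Z : Π x : M, TangentSpace I x}
    (hY : CMDiff 2 (T% Y)) (hZ : CMDiff 2 (T% Z)) :
    CMDiff 2 (fun y ↦ g.val y (Y y) (Z y)) := by
  have h : ContMDiff I (I.prod 𝓘(ℝ)) 2
      (fun m ↦ TotalSpace.mk' ℝ (E := Bundle.Trivial M ℝ) m (g.val m (Y m) (Z m))) :=
    ContMDiff.clm_bundle_apply₂ (F₁ := E) (F₂ := E)
      (g.contMDiff.of_le ENat.LEInfty.out) hY hZ
  intro x
  exact (contMDiffAt_totalSpace.1 (h x)).2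

variable {g} {f : Equiv.Perm M}

lemma isInvertible_mfderiv (hf : f ∈ g.isometryGroup) (x : M) : (mfderiv I I f x).IsInvertible := by
  have h1 : (mfderiv I I f.symm (f x)).comp (mfderiv I I f x) = ContinuousLinearMap.id ℝ _ := by
    rw [← mfderiv_comp x (hf.2.1.mdifferentiableAt (by simp)) (hf.1.mdifferentiableAt (by simp))]
    have : f.symm ∘ f = id := by ext; simp
    rw [this, mfderiv_id]
  have h2 : (mfderiv I I f (f.symm (f x))).comp (mfderiv I I f.symm (f x)) =
      ContinuousLinearMap.id ℝ _ := by
    rw [← mfderiv_comp (f x) (hf.1.mdifferentiableAt (by simp))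
      (hf.2.1.mdifferentiableAt (by simp))]
    have : f ∘ f.symm = id := by ext; simp
    rw [this, mfderiv_id]
  -- `f.symm (f x) = x` is not definitional; all tangent spaces are `E`, so the derivatives of `f` at
  -- the two points can be compared there.
  have h3 : ∀ y, y = x → ∀ w : E,
      (mfderiv I I f y : E →L[ℝ] E) w = (mfderiv I I f x : E →L[ℝ] E) w := by
    rintro _ rfl _; rfl
  refine ⟨ContinuousLinearEquiv.equivOfInverse (mfderiv I I f x) (mfderiv I I f.symm (f x) :)
    (fun w ↦ congr($h1 w)) (fun w ↦ ?_), rfl⟩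
  exact (h3 _ (f.symm_apply_apply x) _).symm.trans congr($h2 w)

variable {X Y Z : Π x : M, TangentSpace I x}

lemma mfderiv_mpullback (hf : f ∈ g.isometryGroup) (x : M) :
    mfderiv I I f x (mpullback I I f X x) = X (f x) :=
  (isInvertible_mfderiv hf x).self_apply_inverse _

lemma val_mpullback (hf : f ∈ g.isometryGroup) (x : M) :
    g.val x (mpullback I I f X x) (mpullback I I f Y x) = g.val (f x) (X (f x)) (Y (f x)) := by
  rw [← hf.2.2, mfderiv_mpullback hf, mfderiv_mpullback hf]

variable [FiniteDimensional ℝ E]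

lemma mdifferentiableAt_mpullback (hf : f ∈ g.isometryGroup) {x : M} (hX : MDiffAt (T% X) (f x)) :
    MDiffAt (T% (mpullback I I f X)) x := by
  have : CompleteSpace E := FiniteDimensional.complete ℝ E
  exact hX.mpullback_vectorField (n := 2) ((hf.1 x).of_le ENat.LEInfty.out)
    (isInvertible_mfderiv hf x) le_rfl

lemma contMDiff_mpullback (hf : f ∈ g.isometryGroup) (hX : CMDiff 2 (T% X)) :
    CMDiff 2 (T% (mpullback I I f X)) := by
  have : CompleteSpace E := FiniteDimensional.complete ℝ E
  have : IsManifold I (2 + 1) M := by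
    norm_num
    infer_instance
  exact ContMDiff.mpullback_vectorField (n := 2 + 1) hX
    (hf.1.of_le (by norm_num; exact ENat.LEInfty.out)) (isInvertible_mfderiv hf) le_rfl

lemma mlieBracket_mpullback (hf : f ∈ g.isometryGroup) {x : M}
    (hX : MDiffAt (T% X) (f x)) (hY : MDiffAt (T% Y) (f x)) :
    mlieBracket I (mpullback I I f X) (mpullback I I f Y) x =
      mpullback I I f (mlieBracket I X Y) x := by
  have : CompleteSpace E := FiniteDimensional.complete ℝ E
  have : IsManifold I (minSmoothness ℝ 3) M := by
    rw [minSmoothness_of_isRCLikeNormedField]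
    infer_instance
  refine (mpullback_mlieBracket hX hY (n := 2) ((hf.1 x).of_le ENat.LEInfty.out) ?_).symm
  rw [minSmoothness_of_isRCLikeNormedField]

lemma koszul_mpullback (hf : f ∈ g.isometryGroup) {x : M}
    (hX : MDiffAt (T% X) (f x)) (hY : MDiffAt (T% Y) (f x)) (hZ : MDiffAt (T% Z) (f x)) :
    g.koszul (mpullback I I f X) (mpullback I I f Y) (mpullback I I f Z) x =
      g.koszul X Y Z (f x) := by
  have key {U V W : Π x : M, TangentSpace I x}
      (hV : MDiffAt (T% V) (f x)) (hW : MDiffAt (T% W) (f x)) :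
      d% (fun y ↦ g.val y (mpullback I I f V y) (mpullback I I f W y)) x (mpullback I I f U x) =
        d% (fun y ↦ g.val y (V y) (W y)) (f x) (U (f x)) := by
    simp only [val_mpullback hf]
    refine (mvfderiv_comp_apply (g := fun y ↦ g.val y (V y) (W y)) x
      (g.mdifferentiableAt_val hV hW) (hf.1.mdifferentiableAt (by simp)) _).trans ?_
    rw [mfderiv_mpullback hf]
  rw [koszul, koszul, key hY hZ, key hX hZ, key hX hY]
  simp only [mlieBracket_mpullback hf hX hY,
    mlieBracket_mpullback hf hX hZ, mlieBracket_mpullback hf hY hZ, val_mpullback hf]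

lemma leviCivita_mpullback (hf : f ∈ g.isometryGroup) {x : M}
    (hX : MDiffAt (T% X) (f x)) (hY : MDiffAt (T% Y) (f x)) :
    g.leviCivita (mpullback I I f Y) x (mpullback I I f X x) =
      mpullback I I f (fun y ↦ g.leviCivita Y y (X y)) x := by
  refine g.ext_val fun w ↦ ?_
  set Z := FiberBundle.extend E (mfderiv I I f x w) with hZdef
  have hZ : MDiffAt (T% Z) (f x) := FiberBundle.mdifferentiableAt_extend I E _
  have hw : w = mpullback I I f Z x := by
    rw [mpullback_apply, hZdef, FiberBundle.extend_apply_self]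
    exact ((isInvertible_mfderiv hf x).inverse_apply_self _).symm
  have h1 := g.leviCivita_apply (mdifferentiableAt_mpullback hf hX)
    (mdifferentiableAt_mpullback hf hY) (mdifferentiableAt_mpullback hf hZ)
  rw [koszul_mpullback hf hX hY hZ, ← g.leviCivita_apply hX hY hZ] at h1
  rw [hw, val_mpullback hf (X := fun y ↦ g.leviCivita Y y (X y))]
  linarith

/-- Isometries preserve the curvature. (The regularity of `∇_X Z` and `∇_Y Z` is assumed, since a
smooth dependence of the Levi-Civita connection on its arguments is only shown on Lie groups.) -/
lemma curvature_mpullback (hf : f ∈ g.isometryGroup)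
    (hX : MDiff (T% X)) (hY : MDiff (T% Y)) (hZ : MDiff (T% Z))
    (hXZ : MDiff (T% (fun y ↦ g.leviCivita Z y (X y))))
    (hYZ : MDiff (T% (fun y ↦ g.leviCivita Z y (Y y)))) (x : M) :
    curvature g.leviCivita (mpullback I I f X) (mpullback I I f Y) (mpullback I I f Z) x =
      mpullback I I f (curvature g.leviCivita X Y Z) x := by
  have e {V : Π x : M, TangentSpace I x} (hV : MDiff (T% V)) :
      (fun y ↦ g.leviCivita (mpullback I I f Z) y (mpullback I I f V y)) =
        mpullback I I f (fun y ↦ g.leviCivita Z y (V y)) :=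
    funext fun y ↦ leviCivita_mpullback hf (hV _) (hZ _)
  -- `∇_u Z` at a point depends only on the value of `u` there, so any differentiable extension of
  -- `[X, Y]_{f x}` may replace the bracket.
  have hb : g.leviCivita (mpullback I I f Z) x (mpullback I I f (mlieBracket I X Y) x) =
      mpullback I I f (fun y ↦ g.leviCivita Z y (mlieBracket I X Y y)) x := by
    set W := FiberBundle.extend E (mlieBracket I X Y (f x)) with hWdef
    have hW : MDiffAt (T% W) (f x) := FiberBundle.mdifferentiableAt_extend I E _
    have := leviCivita_mpullback hf hW (hZ (f x))
    simpa only [mpullback_apply, hWdef, FiberBundle.extend_apply_self] using this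
  simp only [curvature]
  rw [e hX, e hY, leviCivita_mpullback hf (hX _) (hYZ _), leviCivita_mpullback hf (hY _) (hXZ _),
    mlieBracket_mpullback hf (hX _) (hY _), hb]
  simp only [mpullback_apply, curvature, map_sub]

end PseudoRiemannianMetric

/-! ### Tensoriality of the curvature -/

section CurvatureTensoriality

variable {E : Type*} [NormedAddCommGroup E] [NormedSpace ℝ E] [FiniteDimensional ℝ E]
  {H : Type*} [TopologicalSpace H] {I : ModelWithCorners ℝ E H}
  {M : Type*} [TopologicalSpace M] [ChartedSpace H M] [IsManifold I ∞ M]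
  {cov : CovariantDerivative I E (TangentSpace I : M → Type _)}
  (hcov : ∀ {Y Z : Π x : M, TangentSpace I x}, CMDiff 2 (T% Y) → CMDiff 2 (T% Z) →
    MDiff (T% (fun y ↦ cov Z y (Y y))))
  {X X' Y Z Z' : Π x : M, TangentSpace I x} {f : M → ℝ}

lemma curvature_swap (X Y Z : Π x : M, TangentSpace I x) (x : M) :
    curvature cov X Y Z x = -curvature cov Y X Z x := by
  simp only [curvature, mlieBracket_swap_apply (V := X) (W := Y), map_neg]
  abel

include hcov

lemma curvature_add_left (hX : CMDiff 2 (T% X)) (hX' : CMDiff 2 (T% X')) (hZ : CMDiff 2 (T% Z))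
    (x : M) : curvature cov (X + X') Y Z x = curvature cov X Y Z x + curvature cov X' Y Z x := by
  have e : (fun y ↦ cov Z y ((X + X') y)) =
      (fun y ↦ cov Z y (X y)) + (fun y ↦ cov Z y (X' y)) := by
    ext y; simp
  simp only [curvature]
  rw [e, cov.isCovariantDerivativeOnUniv.add (hcov hX hZ x) (hcov hX' hZ x),
    mlieBracket_add_left (hX.mdifferentiable (by simp) x) (hX'.mdifferentiable (by simp) x)]
  simp only [Pi.add_apply, map_add, add_apply]
  abel

lemma curvature_smul_left (hf : CMDiff 2 f) (hX : CMDiff 2 (T% X)) (hZ : CMDiff 2 (T% Z)) (x : M) :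
    curvature cov (f • X) Y Z x = f x • curvature cov X Y Z x := by
  have e : (fun y ↦ cov Z y ((f • X) y)) = f • (fun y ↦ cov Z y (X y)) := by
    ext y; simp
  simp only [curvature]
  rw [e, cov.isCovariantDerivativeOnUniv.leibniz (hcov hX hZ x) (hf.mdifferentiable (by simp) x),
    mlieBracket_smul_left (hf.mdifferentiable (by simp) x) (hX.mdifferentiable (by simp) x)]
  simp only [Pi.smul_apply', map_add, map_smul, add_apply, smul_sub,
    smul_apply, ContinuousLinearMap.smulRight_apply]
  module

lemma curvature_add (hX : CMDiff 2 (T% X)) (hY : CMDiff 2 (T% Y)) (hZ : CMDiff 2 (T% Z))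
    (hZ' : CMDiff 2 (T% Z')) (x : M) :
    curvature cov X Y (Z + Z') x = curvature cov X Y Z x + curvature cov X Y Z' x := by
  have e (V : Π x : M, TangentSpace I x) : (fun y ↦ cov (Z + Z') y (V y)) =
      (fun y ↦ cov Z y (V y)) + (fun y ↦ cov Z' y (V y)) := by
    ext y
    rw [cov.isCovariantDerivativeOnUniv.add (hZ.mdifferentiable (by simp) y)
      (hZ'.mdifferentiable (by simp) y)]
    rfl
  simp only [curvature]
  rw [e, e, cov.isCovariantDerivativeOnUniv.add (hcov hX hZ x) (hcov hX hZ' x),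
    cov.isCovariantDerivativeOnUniv.add (hcov hY hZ x) (hcov hY hZ' x),
    cov.isCovariantDerivativeOnUniv.add (hZ.mdifferentiable (by simp) x)
      (hZ'.mdifferentiable (by simp) x)]
  simp only [add_apply]
  abel

/-- Homogeneity in the differentiated field: the second derivatives of `f` cancel because
`[X, Y] f = X (Y f) - Y (X f)`. -/
lemma curvature_smul (hf : CMDiff 2 f) (hX : CMDiff 2 (T% X)) (hY : CMDiff 2 (T% Y))
    (hZ : CMDiff 2 (T% Z)) (x : M) :
    curvature cov X Y (f • Z) x = f x • curvature cov X Y Z x := by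
  have hfd : MDiff f := hf.mdifferentiable (by simp)
  have hZd : MDiff (T% Z) := hZ.mdifferentiable (by simp)
  have e (V : Π x : M, TangentSpace I x) : (fun y ↦ cov (f • Z) y (V y)) =
      f • (fun y ↦ cov Z y (V y)) + (fun y ↦ d% f y (V y)) • Z := by
    ext y
    rw [cov.isCovariantDerivativeOnUniv.leibniz (hZd y) (hfd y)]
    rfl
  have e2 {V : Π x : M, TangentSpace I x} (hV : CMDiff 2 (T% V)) (W : Π x : M, TangentSpace I x) :
      cov (fun y ↦ cov (f • Z) y (V y)) x (W x) =
        f x • cov (fun y ↦ cov Z y (V y)) x (W x) + d% f x (W x) • cov Z x (V x) +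
        (d% f x (V x) • cov Z x (W x) + d% (fun y ↦ d% f y (V y)) x (W x) • Z x) := by
    have h1 := mdifferentiable_mvfderiv_apply hf (hV.of_le one_le_two) x
    rw [e, cov.isCovariantDerivativeOnUniv.add ((hfd x).smul_section (hcov hV hZ x))
        (h1.smul_section (hZd x)),
      cov.isCovariantDerivativeOnUniv.leibniz (hcov hV hZ x) (hfd x),
      cov.isCovariantDerivativeOnUniv.leibniz (hZd x) h1]
    rfl
  have e3 (u : TangentSpace I x) : cov (f • Z) x u = f x • cov Z x u + d% f x u • Z x := by
    rw [cov.isCovariantDerivativeOnUniv.leibniz (hZd x) (hfd x)]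
    rfl
  have h := mvfderiv_mlieBracket_smul hf hX hY hZ x
  simp only [curvature]
  rw [e2 hY X, e2 hX Y, e3, ← sub_eq_zero, ← h]
  module

end CurvatureTensoriality

namespace PseudoRiemannianMetric

variable {E : Type*} [NormedAddCommGroup E] [NormedSpace ℝ E] [FiniteDimensional ℝ E]
  {H : Type*} [TopologicalSpace H] {I : ModelWithCorners ℝ E H}
  {M : Type*} [TopologicalSpace M] [ChartedSpace H M] [IsManifold I ∞ M]
  (g : PseudoRiemannianMetric I M) {X Y Z : Π x : M, TangentSpace I x}

lemma mdifferentiable_koszul (hX : CMDiff 2 (T% X)) (hY : CMDiff 2 (T% Y))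
    (hZ : CMDiff 2 (T% Z)) : MDiff (g.koszul X Y Z) := by
  have hd {U V W : Π x : M, TangentSpace I x} (hU : CMDiff 2 (T% U)) (hV : CMDiff 2 (T% V))
      (hW : CMDiff 2 (T% W)) : MDiff (fun x ↦ d% (fun y ↦ g.val y (V y) (W y)) x (U x)) :=
    mdifferentiable_mvfderiv_apply (g.contMDiff_val hV hW) (hU.of_le one_le_two)
  have hb {U V W : Π x : M, TangentSpace I x} (hU : CMDiff 2 (T% U)) (hV : CMDiff 2 (T% V))
      (hW : CMDiff 2 (T% W)) : MDiff (fun x ↦ g.val x (mlieBracket I U V x) (W x)) :=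
    fun x ↦ g.mdifferentiableAt_val ((contMDiff_mlieBracket hU hV).mdifferentiable (by simp) x)
      (hW.mdifferentiable (by simp) x)
  exact (((((hd hX hY hZ).add (hd hY hX hZ)).sub (hd hZ hX hY)).add (hb hX hY hZ)).sub
    (hb hX hZ hY)).sub (hb hY hZ hX)

end PseudoRiemannianMetric

/-! ### Left-invariant frames and pointwise dependence of the curvature -/

namespace LeftInvariantMetric

variable {E : Type*} [NormedAddCommGroup E] [NormedSpace ℝ E]
  {H : Type*} [TopologicalSpace H] {I : ModelWithCorners ℝ E H}
  {N : Type*} [TopologicalSpace N] [ChartedSpace H N] [Group N] [LieGroup I ∞ N]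
  (g : LeftInvariantMetric I N)

lemma contMDiff_mulInvariantVectorField_two (w : GroupLieAlgebra I N) :
    CMDiff 2 (T% (mulInvariantVectorField w : Π n : N, TangentSpace I n)) := by
  have : minSmoothness ℝ 2 = 2 := minSmoothness_of_isRCLikeNormedField
  have h := contMDiff_mulInvariantVectorField w
  rwa [this] at h

variable [FiniteDimensional ℝ E]

/-- The dual, with respect to the scalar product, of the chosen basis `Module.finBasis` of the Lie
algebra. -/
def dualVec (i : Fin (Module.finrank ℝ (GroupLieAlgebra I N))) : GroupLieAlgebra I N :=
  ((g.form 1).toDual (g.form_nondegenerate 1)).symm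
    ((Module.finBasis ℝ (GroupLieAlgebra I N)).coord i)

/-- The coefficients of a vector field in the left-invariant frame given by `Module.finBasis`. They
are defined as the products with the dual frame, so that their regularity follows from that of the
metric. -/
def frameCoeff (X : Π n : N, TangentSpace I n)
    (i : Fin (Module.finrank ℝ (GroupLieAlgebra I N))) (n : N) : ℝ :=
  g.val n (X n) (mulInvariantVectorField (g.dualVec i) n)

lemma sum_frameCoeff (X : Π n : N, TangentSpace I n) :
    ∑ i, g.frameCoeff X i • (mulInvariantVectorField
      (Module.finBasis ℝ (GroupLieAlgebra I N) i) : Π n : N, TangentSpace I n) = X := by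
  ext n
  obtain ⟨w, hw⟩ := exists_mulInvariantVectorField_eq n (X n)
  have hc (i) : g.frameCoeff X i n = (Module.finBasis ℝ (GroupLieAlgebra I N)).repr w i := by
    rw [frameCoeff, ← hw, val_mulInvariantVectorField, g.symm]
    exact LinearMap.BilinForm.apply_toDual_symm_apply (hB := g.form_nondegenerate 1) _ w
  have : leftInvariantFieldAt n (∑ i, (Module.finBasis ℝ (GroupLieAlgebra I N)).repr w i •
      Module.finBasis ℝ (GroupLieAlgebra I N) i) = X n := by
    rw [(Module.finBasis ℝ (GroupLieAlgebra I N)).sum_repr]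
    exact hw
  rw [map_sum] at this
  simp only [Finset.sum_apply, Pi.smul_apply', hc]
  rw [← this]
  simp only [map_smul]
  rfl

lemma contMDiff_frameCoeff {X : Π n : N, TangentSpace I n} (hX : CMDiff 2 (T% X)) (i) :
    CMDiff 2 (g.frameCoeff X i) :=
  g.contMDiff_val hX (contMDiff_mulInvariantVectorField_two _)

/-- An additive map that is homogeneous over functions at `n` depends only on the value of the field
at `n`. The metric enters through the coefficients of a field in a left-invariant frame. Unlike in
`TensorialAt`, additivity and homogeneity are required on `C²` fields only. -/
lemma eq_of_tensorial (g : LeftInvariantMetric I N) {n : N} {V : Type*} [AddCommGroup V]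
    [Module ℝ V] {T : (Π n : N, TangentSpace I n) → V}
    (hadd : ∀ {X Y : Π n : N, TangentSpace I n}, CMDiff 2 (T% X) → CMDiff 2 (T% Y) →
      T (X + Y) = T X + T Y)
    (hsmul : ∀ {f : N → ℝ} {X : Π n : N, TangentSpace I n}, CMDiff 2 f → CMDiff 2 (T% X) →
      T (f • X) = f n • T X)
    {X X' : Π n : N, TangentSpace I n} (hX : CMDiff 2 (T% X)) (hX' : CMDiff 2 (T% X'))
    (h : X n = X' n) : T X = T X' := by
  have key {X : Π n : N, TangentSpace I n} (hX : CMDiff 2 (T% X)) :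
      T X = ∑ i, g.frameCoeff X i n •
        T (mulInvariantVectorField (Module.finBasis ℝ (GroupLieAlgebra I N) i)) := by
    have hs (i) : CMDiff 2 (T% (g.frameCoeff X i • (mulInvariantVectorField
        (Module.finBasis ℝ (GroupLieAlgebra I N) i) : Π n : N, TangentSpace I n))) :=
      (g.contMDiff_frameCoeff hX i).smul_section (contMDiff_mulInvariantVectorField_two _)
    conv_lhs => rw [← g.sum_frameCoeff X]
    generalize (Finset.univ : Finset (Fin (Module.finrank ℝ (GroupLieAlgebra I N)))) = s
    induction s using Finset.induction_on with
    | empty =>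
      have := hsmul (f := 0) contMDiff_const (contMDiff_mulInvariantVectorField_two 0)
      simpa using this
    | insert i s hi ih =>
      rw [Finset.sum_insert hi, Finset.sum_insert hi, hadd (hs i), ih,
        hsmul (g.contMDiff_frameCoeff hX i) (contMDiff_mulInvariantVectorField_two _)]
      have := ContMDiff.sum_section (s := s) (fun i _ ↦ hs i)
      simpa using this
  rw [key hX, key hX']
  simp only [frameCoeff, h]

lemma mdifferentiable_of_frameCoeff {X : Π n : N, TangentSpace I n}
    (hX : ∀ i, MDiff (g.frameCoeff X i)) : MDiff (T% X) := by
  rw [← g.sum_frameCoeff X]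
  have := MDifferentiable.sum_section (s := Finset.univ) fun i _ ↦
    mdifferentiable_smul_section (hX i)
      (mdifferentiable_mulInvariantVectorField (Module.finBasis ℝ (GroupLieAlgebra I N) i))
  simpa using this

lemma mdifferentiable_leviCivita {Y Z : Π n : N, TangentSpace I n} (hY : CMDiff 2 (T% Y))
    (hZ : CMDiff 2 (T% Z)) : MDiff (T% (fun y ↦ g.leviCivita Z y (Y y))) := by
  refine g.mdifferentiable_of_frameCoeff fun i ↦ ?_
  have hk := g.mdifferentiable_koszul hY hZ (contMDiff_mulInvariantVectorField_two (g.dualVec i))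
  have e : g.frameCoeff (fun y ↦ g.leviCivita Z y (Y y)) i = (1 / 2 : ℝ) •
      g.koszul Y Z (mulInvariantVectorField (g.dualVec i)) := by
    ext n
    rw [Pi.smul_apply, ← g.leviCivita_apply (hY.mdifferentiable (by simp) n)
      (hZ.mdifferentiable (by simp) n) (mdifferentiable_mulInvariantVectorField _ n)]
    simp [frameCoeff]
  rw [e]
  exact hk.const_smul _

/-- The curvature at `n` depends only on the values at `n` of its three arguments. -/
lemma curvature_congr {n : N} {X X' Y Y' Z Z' : Π n : N, TangentSpace I n}
    (hX : CMDiff 2 (T% X)) (hX' : CMDiff 2 (T% X')) (hY : CMDiff 2 (T% Y))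
    (hY' : CMDiff 2 (T% Y')) (hZ : CMDiff 2 (T% Z)) (hZ' : CMDiff 2 (T% Z'))
    (h1 : X n = X' n) (h2 : Y n = Y' n) (h3 : Z n = Z' n) :
    curvature g.leviCivita X Y Z n = curvature g.leviCivita X' Y' Z' n := by
  have left {X X' Y Z : Π n : N, TangentSpace I n} (hX : CMDiff 2 (T% X)) (hX' : CMDiff 2 (T% X'))
      (hZ : CMDiff 2 (T% Z)) (h : X n = X' n) :
      curvature g.leviCivita X Y Z n = curvature g.leviCivita X' Y Z n :=
    g.eq_of_tensorial (T := fun X ↦ curvature g.leviCivita X Y Z n)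
      (fun hX hX' ↦ curvature_add_left g.mdifferentiable_leviCivita hX hX' hZ n)
      (fun hf hX ↦ curvature_smul_left g.mdifferentiable_leviCivita hf hX hZ n) hX hX' h
  rw [left hX hX' hZ h1, curvature_swap, left hY hY' hZ h2, ← curvature_swap]
  exact g.eq_of_tensorial (T := fun Z ↦ curvature g.leviCivita X' Y' Z n)
    (fun hZ hZ' ↦ curvature_add g.mdifferentiable_leviCivita hX' hY' hZ hZ' n)
    (fun hf hZ ↦ curvature_smul g.mdifferentiable_leviCivita hf hX' hY' hZ n) hZ hZ' h3

end LeftInvariantMetric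

/-! ### Invariant subspaces over the complexification -/

/-- If `W ⊗ ℂ` is a sum of generalized eigenspaces of the complexification of `T`, then `W` is
invariant under every automorphism that commutes with `T`. -/
lemma Submodule.map_eq_of_baseChange_eq_iSup_maxGenEigenspace {V : Type*} [AddCommGroup V]
    [Module ℝ V] [FiniteDimensional ℝ V] {T : Module.End ℝ V} (A : V ≃ₗ[ℝ] V)
    (hA : ∀ v, T (A v) = A (T v)) {W : Submodule ℝ V} {S : Set ℂ}
    (hW : W.baseChange ℂ = ⨆ μ ∈ S, Module.End.maxGenEigenspace (T.baseChange ℂ) μ) :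
    W.map A.toLinearMap = W := by
  refine Submodule.eq_of_le_of_finrank_eq ?_ (LinearEquiv.finrank_map_eq A W)
  have hB : Commute (T.baseChange ℂ : Module.End ℂ (ℂ ⊗[ℝ] V))
      (A.toLinearMap.baseChange ℂ : Module.End ℂ (ℂ ⊗[ℝ] V)) := by
    have : T ∘ₗ A.toLinearMap = A.toLinearMap ∘ₗ T := LinearMap.ext hA
    rw [commute_iff_eq, Module.End.mul_eq_comp, Module.End.mul_eq_comp,
      ← LinearMap.baseChange_comp, ← LinearMap.baseChange_comp, this]
  have hmap : W.baseChange ℂ ≤ (W.baseChange ℂ).comap (A.toLinearMap.baseChange ℂ) := by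
    rw [hW]
    refine iSup₂_le fun μ hμ x hx ↦ ?_
    exact Submodule.mem_iSup_of_mem μ (Submodule.mem_iSup_of_mem hμ
      (Module.End.mapsTo_maxGenEigenspace_of_comm hB μ hx))
  rw [← Submodule.baseChange_le_iff (A := ℂ), Submodule.baseChange_eq_span, Submodule.span_le]
  rintro _ ⟨_, ⟨w, hw, rfl⟩, rfl⟩
  exact hmap (Submodule.tmul_mem_baseChange_of_mem 1 hw)

/-! ### The differential of an isometry in left-invariant frames -/

namespace LeftInvariantMetric

variable {E : Type*} [NormedAddCommGroup E] [NormedSpace ℝ E]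
  {H : Type*} [TopologicalSpace H] {I : ModelWithCorners ℝ E H}
  {N : Type*} [TopologicalSpace N] [ChartedSpace H N] [Group N] [LieGroup I ∞ N]

lemma leftInvariantFieldAt_bijective (g : LeftInvariantMetric I N) (n : N) :
    Function.Bijective (leftInvariantFieldAt (I := I) n) := by
  refine ⟨(injective_iff_map_eq_zero _).2 fun u hu ↦ g.nondegenerate 1 u fun v ↦ ?_,
    exists_mulInvariantVectorField_eq n⟩
  have hu : mulInvariantVectorField u n = 0 := hu
  rw [← g.val_mulInvariantVectorField u v n, hu]
  simp

variable {g : LeftInvariantMetric I N} {f : Equiv.Perm N}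

/-- The differential of an isometry at `n`, read in the left-invariant frames at `n` and `f n`: the
automorphism `A` of the Lie algebra with `df_n (u_n) = (A u)_{f n}`. No translation back to the
identity is needed, so that no transport between the tangent spaces at equal points occurs. -/
def frameDifferential (hf : f ∈ g.isometryGroup) (n : N) :
    GroupLieAlgebra I N ≃ₗ[ℝ] GroupLieAlgebra I N :=
  (LinearEquiv.ofBijective _ (g.leftInvariantFieldAt_bijective n)).trans
    ((LinearEquiv.ofBijective (mfderiv I I f n).toLinearMap
      (PseudoRiemannianMetric.isInvertible_mfderiv hf n).bijective).trans
    (LinearEquiv.ofBijective _ (g.leftInvariantFieldAt_bijective (f n))).symm)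

lemma mulInvariantVectorField_frameDifferential (hf : f ∈ g.isometryGroup) (n : N)
    (u : GroupLieAlgebra I N) :
    mulInvariantVectorField (frameDifferential hf n u) (f n) =
      mfderiv I I f n (mulInvariantVectorField u n) :=
  (LinearEquiv.ofBijective _ (g.leftInvariantFieldAt_bijective (f n))).apply_symm_apply _

lemma val_frameDifferential (hf : f ∈ g.isometryGroup) (n : N) (u v : GroupLieAlgebra I N) :
    g.val 1 (frameDifferential hf n u) (frameDifferential hf n v) = g.val 1 u v := by
  rw [← g.val_mulInvariantVectorField _ _ (f n), mulInvariantVectorField_frameDifferential,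
    mulInvariantVectorField_frameDifferential, hf.2.2, val_mulInvariantVectorField]

lemma map_leftInvariantDistribution (hf : f ∈ g.isometryGroup) (n : N)
    (W : Submodule ℝ (GroupLieAlgebra I N)) :
    (leftInvariantDistribution W n).map (mfderiv I I f n).toLinearMap =
      leftInvariantDistribution (W.map (frameDifferential hf n).toLinearMap) (f n) := by
  rw [leftInvariantDistribution, leftInvariantDistribution]
  refine (Submodule.map_comp _ _ _).symm.trans (Eq.trans ?_ (Submodule.map_comp _ _ _))
  congr 1
  ext u
  exact (mulInvariantVectorField_frameDifferential hf n u).symm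

variable [FiniteDimensional ℝ E]

lemma curvature_mulInvariantVectorField_apply (u v w : GroupLieAlgebra I N) (n : N) :
    curvature g.leviCivita (mulInvariantVectorField u) (mulInvariantVectorField v)
      (mulInvariantVectorField w) n = mulInvariantVectorField (g.curvatureEndo v w u) n := by
  have hb : mlieBracket I (mulInvariantVectorField u) (mulInvariantVectorField v) n =
      mulInvariantVectorField ⁅u, v⁆ n :=
    (congrFun (mulInvariantVector_mlieBracket u v) n).symm
  simp only [curvature, leviCivita_mulInvariantVectorField, hb, curvatureEndo_apply]
  have hs (a b : GroupLieAlgebra I N) : mulInvariantVectorField (a - b) n =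
      mulInvariantVectorField a n - mulInvariantVectorField b n :=
    map_sub (leftInvariantFieldAt n) a b
  rw [hs, hs]

/-- The differential of an isometry preserves the curvature: `A (R(ξ, u)w) = R(A ξ, A u)(A w)`. -/
lemma frameDifferential_curvatureEndo (hf : f ∈ g.isometryGroup) (n : N)
    (u w ξ : GroupLieAlgebra I N) :
    frameDifferential hf n (g.curvatureEndo u w ξ) =
      g.curvatureEndo (frameDifferential hf n u) (frameDifferential hf n w)
        (frameDifferential hf n ξ) := by
  set A := frameDifferential hf n
  have hC (u : GroupLieAlgebra I N) := contMDiff_mulInvariantVectorField_two (I := I) (N := N) u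
  have hD (u : GroupLieAlgebra I N) := mdifferentiable_mulInvariantVectorField (I := I) (G := N) u
  -- The field `f^*(A u)` is not left-invariant, but it has the value of `u` at `n`.
  have hp (u : GroupLieAlgebra I N) :
      mulInvariantVectorField u n = mpullback I I f (mulInvariantVectorField (A u)) n := by
    rw [mpullback_apply, mulInvariantVectorField_frameDifferential]
    exact ((PseudoRiemannianMetric.isInvertible_mfderiv hf n).inverse_apply_self _).symm
  have hm (u : GroupLieAlgebra I N) := PseudoRiemannianMetric.contMDiff_mpullback hf (hC u)
  have h1 := g.curvature_congr (hC ξ) (hm (A ξ)) (hC u) (hm (A u)) (hC w) (hm (A w))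
    (hp ξ) (hp u) (hp w)
  rw [PseudoRiemannianMetric.curvature_mpullback hf (hD _) (hD _) (hD _)
    (g.mdifferentiable_leviCivita (hC _) (hC _)) (g.mdifferentiable_leviCivita (hC _) (hC _)),
    curvature_mulInvariantVectorField_apply] at h1
  apply (g.leftInvariantFieldAt_bijective (f n)).1
  change mulInvariantVectorField _ _ = mulInvariantVectorField _ _
  rw [mulInvariantVectorField_frameDifferential, h1, PseudoRiemannianMetric.mfderiv_mpullback hf,
    curvature_mulInvariantVectorField_apply]

lemma ricci_frameDifferential (hf : f ∈ g.isometryGroup) (n : N) (u w : GroupLieAlgebra I N) :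
    g.ricci (frameDifferential hf n u) (frameDifferential hf n w) = g.ricci u w := by
  have : g.curvatureEndo (frameDifferential hf n u) (frameDifferential hf n w) =
      (frameDifferential hf n).conj (g.curvatureEndo u w) := by
    ext ξ
    rw [LinearEquiv.conj_apply_apply, frameDifferential_curvatureEndo,
      LinearEquiv.apply_symm_apply]
  change LinearMap.trace ℝ _ _ = LinearMap.trace ℝ _ _
  rw [this, LinearMap.trace_conj']

lemma ricciOperator_frameDifferential (hf : f ∈ g.isometryGroup) (n : N)
    (u : GroupLieAlgebra I N) :
    g.ricciOperator (frameDifferential hf n u) = frameDifferential hf n (g.ricciOperator u) := by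
  refine g.ext_val fun w ↦ ?_
  obtain ⟨w, rfl⟩ := (frameDifferential hf n).surjective w
  rw [ricciOperator_apply, ricci_frameDifferential, val_frameDifferential, ricciOperator_apply]

end LeftInvariantMetric

end

theorem lemma4p3
    {E : Type*} [NormedAddCommGroup E] [NormedSpace ℝ E] [FiniteDimensional ℝ E]
    {H : Type*} [TopologicalSpace H] {I : ModelWithCorners ℝ E H} [I.Boundaryless]
    {N : Type*} [TopologicalSpace N] [ChartedSpace H N] [Group N] [LieGroup I ∞ N]
    (hN : LieModule.nilpotencyLength (GroupLieAlgebra I N) (GroupLieAlgebra I N) = 2)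
    (g : LeftInvariantMetric I N)
    (hg : g.HasNondegenerateCenter)
    (S : Set ℂ) (hS : S ⊆ {μ | g.complexRicciOperator.HasEigenvalue μ})
    (hv : g.orthogonalCenter.baseChange ℂ =
      ⨆ μ ∈ S, g.complexRicciOperator.maxGenEigenspace μ)
    (hz : (LeftInvariantMetric.centerSubspace I N).baseChange ℂ =
      ⨆ μ ∈ {μ | g.complexRicciOperator.HasEigenvalue μ} \ S,
        g.complexRicciOperator.maxGenEigenspace μ) :
    g.isometryGroup = g.splittingIsometryGroup := by
  refine le_antisymm (fun f hf ↦ ⟨hf, fun n ↦ ?_⟩) fun f hf ↦ hf.1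
  have hA := LeftInvariantMetric.ricciOperator_frameDifferential hf n
  rw [LeftInvariantMetric.map_leftInvariantDistribution hf,
    LeftInvariantMetric.map_leftInvariantDistribution hf,
    Submodule.map_eq_of_baseChange_eq_iSup_maxGenEigenspace _ hA hv,
    Submodule.map_eq_of_baseChange_eq_iSup_maxGenEigenspace _ hA hz]
  exact ⟨rfl, rfl⟩
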